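/- Let $M\ge 1$, ${\cal T}>0$, $\kappa>0$, $\alpha_1,\dots,\alpha_M\in\mathbb R$, let $\ell$ be $C^1$ on $[0,{\cal T}]$, and let $c_1,\dots,c_M,c_g\colon\mathbb R\to[0,\infty)$ be $C^2$ with second derivatives bounded below by a common $\mu>0$ (A1). For a vector $v\in\mathbb R^M$ write $v_\sigma=\sum_i v_i$. For $t_0\in[0,{\cal T}]$ and $x,z\in\mathbb R^M$ let $$J^\star(x,z,t_0)=\inf_u\int_{t_0}^{\cal T}\Bigl[\sum_{i}c_i(x_i(t))+c_g(\ell(t)-z_\sigma(t))+\kappa\bigl(u_\sigma(t)-\tfrac{d}{dt}\ell(t)\bigr)^2\Bigr]dt ,$$ the infimum being over continuous $u\colon[t_0,{\cal T}]\to\mathbb R^M$, subject to $\frac{d}{dt}x_i=-\alpha_ix_i-z_i$, $\frac{d}{dt}z_i=u_i$ on $[t_0,{\cal T}]$ and $x(t_0)=x$, $z(t_0)=z$. Let $K^\star(r,s,t_0)=\inf\{J^\star(x,z,t_0): x_\sigma=r,\ z_\sigma=s\}$, and let $K^\star_{1,0,0}=\partial K^\star/\partial r$. An optimal solution from $(x,z)$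 at time $t_0\in[0,{\cal T})$ is a triple $(x^\star,z^\star,u^\star)$ on $(t_0,{\cal T}]$ with $u^\star$ continuous, satisfying the above differential equations on $(t_0,{\cal T}]$ (so that $(x^\star,z^\star)$ is $C^1$ there), having right limits $x^\star(t_0):=x^\star(t_0+)$, $z^\star(t_0):=z^\star(t_0+)$ with $x^\star_\sigma(t_0)=x_\sigma$, $z^\star_\sigma(t_0)=z_\sigma$, and whose cost over $(t_0,{\cal T}]$ is finite and equal to $J^\star(x,z,t_0)$; thus the state may jump at time $t_0$ with the sums $x_\sigma,z_\sigma$ preserved. Assume that: (A2) for each $t_0\in[0,{\cal T})$ and each $(x,z)$ there is exactly one optimal solution; (A3) $K^\star$ is $C^1$ on $\mathbb R\times\mathbb R\times[0,{\cal T}]$. Let $(x^\star,z^\star,u^\star)$ be the optimal solution from some initial condition at time $0$, put $\lambda^\star(t)=K^\star_{1,0,0}(x^\star_\sigma(t),z^\star_\sigma(t),t)$ for $0\le t\le{\cal T}$, and assume that (A4) $\lambda^\star$ is $C^2$ on $(0,{\cal T}]$. Then $\lambda^\star$ is $C^2$ on $[0,{\cal T}]$ (with one-sided derivatives at the end points),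 and for each $i\in\{1,\dots,M\}$ the post-jump state satisfies $$c_i'(x_i^\star(0+))=\alpha_iK^\star_{1,0,0}(x^\star_\sigma(0),z^\star_\sigma(0),0)-\frac{d}{dt}K^\star_{1,0,0}(x^\star_\sigma(t),z^\star_\sigma(t),t)\Big|_{t=0},$$ $$z_i^\star(0+)=-\alpha_ix_i^\star(0+)-\frac{1}{c_i''(x_i^\star(0+))}\Bigl[\alpha_i\frac{d}{dt}K^\star_{1,0,0}(x^\star_\sigma(t),z^\star_\sigma(t),t)\Big|_{t=0}-\frac{d^2}{dt^2}K^\star_{1,0,0}(x^\star_\sigma(t),z^\star_\sigma(t),t)\Big|_{t=0}\Bigr].$$ -/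

import Mathlib

open Set Filter Topology

namespace DemandDispatch

/-- Data of the finite-horizon resource allocation problem with `M` load classes: horizon `T`,
net load `ℓ`, leakage rates `α`, state-of-charge costs `c`, generation cost `cg`, and the
coefficient `κ` of the quadratic ramping cost `κ γ ^ 2`. -/
structure Model (M : ℕ) where
  T : ℝ
  ℓ : ℝ → ℝ
  α : Fin M → ℝ
  c : Fin M → ℝ → ℝ
  cg : ℝ → ℝ
  κ : ℝ

/-- A class `C²`, non-negative function whose second derivative is at least `μ`. -/
structure IsCost (μ : ℝ) (f : ℝ → ℝ) : Prop where
  nonneg : ∀ r, 0 ≤ f r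
  contDiff : ContDiff ℝ 2 f
  strong : ∀ r, μ ≤ deriv (deriv f) r

variable {M : ℕ}

namespace Model

/-- Standing regularity assumptions on the data (A1). -/
structure Regular (P : Model M) : Prop where
  horizon_pos : 0 < P.T
  load : ContDiffOn ℝ 1 P.ℓ (Icc 0 P.T)
  ramp_pos : 0 < P.κ
  costs : ∃ μ : ℝ, 0 < μ ∧ (∀ i, IsCost μ (P.c i)) ∧ IsCost μ P.cg

/-- The running cost `c(x, z, u, t)`, after eliminating `g = ℓ - z_σ` and `γ = ℓ' - u_σ`. -/
noncomputable def runningCost (P : Model M) (x z u : Fin M → ℝ) (t : ℝ) : ℝ :=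
  (∑ i, P.c i (x i)) + P.cg (P.ℓ t - ∑ i, z i)
    + P.κ * ((∑ i, u i) - derivWithin P.ℓ (Icc 0 P.T) t) ^ 2

/-- The total cost over `[t₀, T]`. -/
noncomputable def cost (P : Model M) (t₀ : ℝ) (x z u : ℝ → Fin M → ℝ) : ℝ :=
  ∫ t in t₀..P.T, P.runningCost (x t) (z t) (u t) t

/-- `(x, z)` is the state trajectory on `[t₀, T]` driven by the continuous input `u` from the
initial condition `(x₀, z₀)` at time `t₀`. -/
structure IsAdmissible (P : Model M) (t₀ : ℝ) (x₀ z₀ : Fin M → ℝ)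
    (x z u : ℝ → Fin M → ℝ) : Prop where
  input_cont : ContinuousOn u (Icc t₀ P.T)
  soc : ∀ t ∈ Icc t₀ P.T, ∀ i,
    HasDerivWithinAt (fun s => x s i) (-P.α i * x t i - z t i) (Icc t₀ P.T) t
  ramp : ∀ t ∈ Icc t₀ P.T, ∀ i,
    HasDerivWithinAt (fun s => z s i) (u t i) (Icc t₀ P.T) t
  init_soc : x t₀ = x₀
  init_power : z t₀ = z₀

/-- The cost-to-go `J⋆(x₀, z₀, t₀)`: an infimum over continuous inputs. -/
noncomputable def J (P : Model M) (x₀ z₀ : Fin M → ℝ) (t₀ : ℝ) : ℝ :=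
  sInf {v | ∃ x z u : ℝ → Fin M → ℝ, P.IsAdmissible t₀ x₀ z₀ x z u ∧ v = P.cost t₀ x z u}

/-- The value function `K⋆(r, s, t₀)`: the infimum of `J⋆` over all states with aggregate
state of charge `r` and aggregate power deviation `s`. -/
noncomputable def K (P : Model M) (r s t₀ : ℝ) : ℝ :=
  sInf {v | ∃ x z : Fin M → ℝ, ∑ i, x i = r ∧ ∑ i, z i = s ∧ v = P.J x z t₀}

/-- The partial derivative `K⋆_{1,0,0}` of `K⋆` in its first argument. -/
noncomputable def K100 (P : Model M) (r s t : ℝ) : ℝ :=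
  deriv (fun r' => P.K r' s t) r

/-- The function `t ↦ K⋆_{1,0,0}(x_σ(t), z_σ(t), t)` along a trajectory. -/
noncomputable def marginal (P : Model M) (x z : ℝ → Fin M → ℝ) (t : ℝ) : ℝ :=
  P.K100 (∑ i, x t i) (∑ i, z t i) t

/-- A solution `(x, z, u)` of the state equations on `(t₀, T]` with `u` continuous there, so that
`(x, z)` is `C¹` on `(t₀, T]`. The initial impulse may move the state from `(x₀, z₀)`, preserving
the two aggregates; `(x t₀, z t₀)` denotes the post-jump state `(x(t₀+), z(t₀+))`. -/
structure IsPostJumpTrajectory (P : Model M) (t₀ : ℝ) (x₀ z₀ : Fin M → ℝ)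
    (x z u : ℝ → Fin M → ℝ) : Prop where
  input_cont : ContinuousOn u (Ioc t₀ P.T)
  soc : ∀ t ∈ Ioc t₀ P.T, ∀ i,
    HasDerivWithinAt (fun s => x s i) (-P.α i * x t i - z t i) (Ioc t₀ P.T) t
  ramp : ∀ t ∈ Ioc t₀ P.T, ∀ i,
    HasDerivWithinAt (fun s => z s i) (u t i) (Ioc t₀ P.T) t
  limit_soc : Tendsto x (𝓝[>] t₀) (𝓝 (x t₀))
  limit_power : Tendsto z (𝓝[>] t₀) (𝓝 (z t₀))
  sum_soc : ∑ i, x t₀ i = ∑ i, x₀ i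
  sum_power : ∑ i, z t₀ i = ∑ i, z₀ i

/-- An optimal solution from `(x₀, z₀)` at time `t₀`: a post-jump trajectory of finite cost that
attains the cost-to-go. -/
structure IsOptimal (P : Model M) (t₀ : ℝ) (x₀ z₀ : Fin M → ℝ)
    (x z u : ℝ → Fin M → ℝ) : Prop where
  trajectory : P.IsPostJumpTrajectory t₀ x₀ z₀ x z u
  integrable : IntervalIntegrable (fun t => P.runningCost (x t) (z t) (u t) t)
    MeasureTheory.volume t₀ P.T
  attains : P.cost t₀ x z u = P.J x₀ z₀ t₀

/-- Existence and uniqueness of optimal solutions (A2). -/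
def UniquelySolvable (P : Model M) : Prop :=
  ∀ t₀ ∈ Ico 0 P.T, ∀ x₀ z₀ : Fin M → ℝ, ∃ x z u : ℝ → Fin M → ℝ,
    P.IsOptimal t₀ x₀ z₀ x z u ∧
      ∀ x' z' u' : ℝ → Fin M → ℝ, P.IsOptimal t₀ x₀ z₀ x' z' u' →
        EqOn x' x (Ioc t₀ P.T) ∧ EqOn z' z (Ioc t₀ P.T) ∧ EqOn u' u (Ioc t₀ P.T)

/-- The value function `K⋆` is `C¹` on `ℝ × ℝ × [0, T]` (A3). -/
def SmoothValue (P : Model M) : Prop :=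
  ContDiffOn ℝ 1 (fun p : ℝ × ℝ × ℝ => P.K p.1 p.2.1 p.2.2) (univ ×ˢ univ ×ˢ Icc 0 P.T)

end Model

end DemandDispatch

namespace DemandDispatch

/-! The proof rests on the costate equation: with `λ` the marginal value along the optimal solution,
`λ' = α_i λ - c_i'(x_i)` on `[0, T]` for every class `i`. Since `x` is differentiable up to the jump
time, a second differentiation gives `λ'' = α_i λ' - c_i''(x_i) x_i'` with `x_i' = -α_i x_i - z_i`.
At time `0` the first relation yields `c_i'(x_i)`, and the second is solved for `z_i` because `c_i''
> 0`.

The costate equation is an envelope argument. Shift the state of charge of class `i` at time `τ` by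
`ε` and keep `z` and `u`: the trajectory changes by `ε * exp (-α_i (t - τ))` in that class only. The
perturbed cost dominates `K` at aggregate `x_σ(τ) + ε`, with equality at `ε = 0`, so the derivatives
agree and `λ(τ)` is the integral of `c_i'(x_i(t)) * exp (-α_i (t - τ))` over `[τ, T]`
(`IsOptimal.marginal_eq_integral`). Differentiation in `τ` gives the equation on `(0, T)`;
continuity of `λ` carries it to the end points.

Equality at `ε = 0` says that tails of the optimal solution attain `K` (`IsOptimal.cost_tail_eq`).
This needs `J` to depend on the aggregates alone: differences between classes can be removed in time
`η` at cost `O(η)`, because power and ramping are charged only through their sums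
(`IsTrajectoryOn.exists_steering`). -/

theorem hasDerivWithinAt_ite_Icc {f g f' g' : ℝ → ℝ} {a b c : ℝ}
    (hf : ∀ t ∈ Icc a b, HasDerivWithinAt f (f' t) (Icc a b) t)
    (hg : ∀ t ∈ Icc b c, HasDerivWithinAt g (g' t) (Icc b c) t)
    (hab : a ≤ b) (hbc : b ≤ c) (h₀ : f b = g b) (h₁ : f' b = g' b) :
    ∀ t ∈ Icc a c, HasDerivWithinAt (fun s => if s ≤ b then f s else g s)
      (if t ≤ b then f' t else g' t) (Icc a c) t := by
  intro t ht
  have hF : ∀ s ∈ Icc a b, (fun s => if s ≤ b then f s else g s) s = f s := fun s hs => if_pos hs.2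
  have hG : ∀ s ∈ Icc b c, (fun s => if s ≤ b then f s else g s) s = g s := by
    intro s hs
    rcases hs.1.eq_or_lt with rfl | h
    · simpa using h₀
    · simp [not_le.2 h]
  rw [← Icc_union_Icc_eq_Icc hab hbc]
  refine HasDerivWithinAt.union ?_ ?_
  · by_cases h : t ≤ b
    · rw [if_pos h]
      exact (hf t ⟨ht.1, h⟩).congr hF (hF t ⟨ht.1, h⟩)
    · refine HasFDerivWithinAt.of_notMem_closure ?_
      rw [isClosed_Icc.closure_eq]
      exact fun h' => h h'.2
  · by_cases h : b ≤ t
    · have : (if t ≤ b then f' t else g' t) = g' t := by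
        rcases h.eq_or_lt with rfl | h
        · simpa using h₁
        · simp [not_le.2 h]
      rw [this]
      exact (hg t ⟨h, ht.2⟩).congr hG (hG t ⟨h, ht.2⟩)
    · refine HasFDerivWithinAt.of_notMem_closure ?_
      rw [isClosed_Icc.closure_eq]
      exact fun h' => h h'.1

open Polynomial in
/-- Polynomial profiles with prescribed `3`-jets `s`, `s ^ 2`, `s ^ 3` at `0` and vanishing
`3`-jets at `1`. -/
theorem exists_profiles : ∃ p : Fin 3 → ℝ[X],
    (∀ k, (p k).eval 0 = 0 ∧ (p k).eval 1 = 0 ∧ (derivative (p k)).eval 1 = 0 ∧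
      (derivative (derivative (p k))).eval 1 = 0 ∧
      (derivative (derivative (derivative (p k)))).eval 1 = 0) ∧
    (derivative (p 0)).eval 0 = 1 ∧ (derivative (p 1)).eval 0 = 0 ∧
    (derivative (p 2)).eval 0 = 0 ∧
    (derivative (derivative (p 0))).eval 0 = 0 ∧ (derivative (derivative (p 1))).eval 0 = 2 ∧
    (derivative (derivative (p 2))).eval 0 = 0 ∧
    (derivative (derivative (derivative (p 0)))).eval 0 = 0 ∧
    (derivative (derivative (derivative (p 1)))).eval 0 = 0 ∧
    (derivative (derivative (derivative (p 2)))).eval 0 = 6 := by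
  -- The factor `(1 - X) ^ 4` kills the jet at `1`; the last factors truncate the series of `(1 -
  -- X)⁻⁴`, so each entry is its monomial plus `O(X ^ 4)`.
  refine ⟨![X * (1 - X) ^ 4 * (1 + 4 * X + 10 * X ^ 2), X ^ 2 * (1 - X) ^ 4 * (1 + 4 * X),
    X ^ 3 * (1 - X) ^ 4], ?_, ?_⟩
  · intro k
    fin_cases k <;> simp [derivative_pow]
  · simp [derivative_pow]
    norm_num

variable {M : ℕ}

/-! ### Trajectories, concatenation and perturbation -/

namespace Model

/-- `(x, z)` is a state trajectory on `[a, b]` driven by the continuous input `u`. -/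
structure IsTrajectoryOn (P : Model M) (a b : ℝ) (x z u : ℝ → Fin M → ℝ) : Prop where
  input_cont : ContinuousOn u (Icc a b)
  soc : ∀ t ∈ Icc a b, ∀ i,
    HasDerivWithinAt (fun s => x s i) (-P.α i * x t i - z t i) (Icc a b) t
  ramp : ∀ t ∈ Icc a b, ∀ i, HasDerivWithinAt (fun s => z s i) (u t i) (Icc a b) t

variable {P : Model M} {a b c : ℝ} {x z u x' z' u' : ℝ → Fin M → ℝ}

theorem IsAdmissible.isTrajectoryOn {x₀ z₀ : Fin M → ℝ} (h : P.IsAdmissible a x₀ z₀ x z u) :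
    P.IsTrajectoryOn a P.T x z u :=
  ⟨h.input_cont, h.soc, h.ramp⟩

namespace IsTrajectoryOn

theorem isAdmissible (h : P.IsTrajectoryOn a P.T x z u) :
    P.IsAdmissible a (x a) (z a) x z u :=
  ⟨h.input_cont, h.soc, h.ramp, rfl, rfl⟩

theorem mono (h : P.IsTrajectoryOn a b x z u) {a' b' : ℝ} (hs : Icc a' b' ⊆ Icc a b) :
    P.IsTrajectoryOn a' b' x z u :=
  ⟨h.input_cont.mono hs, fun t ht i => (h.soc t (hs ht) i).mono hs,
    fun t ht i => (h.ramp t (hs ht) i).mono hs⟩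

theorem continuousOn_soc (h : P.IsTrajectoryOn a b x z u) (i : Fin M) :
    ContinuousOn (fun t => x t i) (Icc a b) :=
  fun t ht => (h.soc t ht i).continuousWithinAt

theorem continuousOn_power (h : P.IsTrajectoryOn a b x z u) (i : Fin M) :
    ContinuousOn (fun t => z t i) (Icc a b) :=
  fun t ht => (h.ramp t ht i).continuousWithinAt

theorem continuousOn_input (h : P.IsTrajectoryOn a b x z u) (i : Fin M) :
    ContinuousOn (fun t => u t i) (Icc a b) :=
  (continuous_apply i).comp_continuousOn h.input_cont

/-- Concatenation of trajectories. -/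
theorem glue (h : P.IsTrajectoryOn a b x z u) (h' : P.IsTrajectoryOn b c x' z' u')
    (hab : a ≤ b) (hbc : b ≤ c) (hx : x b = x' b) (hz : z b = z' b) (hu : u b = u' b) :
    P.IsTrajectoryOn a c (fun t => if t ≤ b then x t else x' t)
      (fun t => if t ≤ b then z t else z' t) (fun t => if t ≤ b then u t else u' t) := by
  refine ⟨?_, fun t ht i => ?_, fun t ht i => ?_⟩
  · rw [← Icc_union_Icc_eq_Icc hab hbc]
    refine ContinuousOn.union_of_isClosed ?_ ?_ isClosed_Icc isClosed_Icc
    · exact h.input_cont.congr fun t ht => if_pos ht.2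
    · refine h'.input_cont.congr fun t ht => ?_
      rcases ht.1.eq_or_lt with rfl | hlt
      · simpa using hu
      · simp [not_le.2 hlt]
  · have := hasDerivWithinAt_ite_Icc (fun t ht => h.soc t ht i) (fun t ht => h'.soc t ht i)
      hab hbc (by rw [hx]) (by simp [hx, hz]) t ht
    convert this using 1
    · funext s; split_ifs <;> rfl
    · split_ifs <;> rfl
  · have := hasDerivWithinAt_ite_Icc (fun t ht => h.ramp t ht i) (fun t ht => h'.ramp t ht i)
      hab hbc (by rw [hz]) (by simp [hu]) t ht
    convert this using 1
    · funext s; split_ifs <;> rfl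
    · split_ifs <;> rfl

/-- A flat parametrization of the linear dynamics: an arbitrary function `Y` generates a solution of
the state equations with `Y' - αY` as state of charge, so boundary conditions on state and input
become conditions on the jets of `Y`. -/
theorem add_perturbation (h : P.IsTrajectoryOn a b x z u) {Y Y₁ Y₂ Y₃ : ℝ → Fin M → ℝ}
    (h₀ : ∀ t i, HasDerivAt (fun s => Y s i) (Y₁ t i) t)
    (h₁ : ∀ t i, HasDerivAt (fun s => Y₁ s i) (Y₂ t i) t)
    (h₂ : ∀ t i, HasDerivAt (fun s => Y₂ s i) (Y₃ t i) t)
    (h₃ : ∀ i, Continuous fun s => Y₃ s i) :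
    P.IsTrajectoryOn a b (fun t i => x t i + (Y₁ t i - P.α i * Y t i))
      (fun t i => z t i + (-Y₂ t i + P.α i ^ 2 * Y t i))
      (fun t i => u t i + (-Y₃ t i + P.α i ^ 2 * Y₁ t i)) := by
  refine ⟨?_, fun t ht i => ?_, fun t ht i => ?_⟩
  · refine continuousOn_pi.2 fun i => (h.continuousOn_input i).add (Continuous.continuousOn ?_)
    have : Continuous fun s => Y₁ s i :=
      continuous_iff_continuousAt.2 fun t => (h₁ t i).continuousAt
    exact (h₃ i).neg.add (this.const_mul _)
  · refine ((h.soc t ht i).add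
      ((h₁ t i).sub ((h₀ t i).const_mul (P.α i))).hasDerivWithinAt).congr_deriv ?_
    ring
  · exact (h.ramp t ht i).add
      ((h₂ t i).neg.add ((h₀ t i).const_mul (P.α i ^ 2))).hasDerivWithinAt

end IsTrajectoryOn

/-! ### Regularity of the running cost -/

theorem Regular.runningCost_nonneg (hP : P.Regular) (x z u : Fin M → ℝ) (t : ℝ) :
    0 ≤ P.runningCost x z u t := by
  obtain ⟨μ, -, hc, hg⟩ := hP.costs
  have := hP.ramp_pos
  have := Finset.sum_nonneg fun i (_ : i ∈ Finset.univ) => (hc i).nonneg (x i)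
  have := hg.nonneg (P.ℓ t - ∑ i, z i)
  unfold runningCost
  positivity

theorem Regular.contDiff_cost (hP : P.Regular) (i : Fin M) : ContDiff ℝ 2 (P.c i) := by
  obtain ⟨μ, -, hc, -⟩ := hP.costs
  exact (hc i).contDiff

theorem Regular.continuousOn_deriv_load (hP : P.Regular) :
    ContinuousOn (derivWithin P.ℓ (Icc 0 P.T)) (Icc 0 P.T) :=
  hP.load.continuousOn_derivWithin (uniqueDiffOn_Icc hP.horizon_pos) le_rfl

theorem IsTrajectoryOn.continuousOn_runningCost (h : P.IsTrajectoryOn a b x z u)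
    (hP : P.Regular) (hs : Icc a b ⊆ Icc 0 P.T) :
    ContinuousOn (fun t => P.runningCost (x t) (z t) (u t) t) (Icc a b) := by
  obtain ⟨μ, -, hc, hg⟩ := hP.costs
  have hsum := continuousOn_finsetSum Finset.univ fun i _ => h.continuousOn_power i
  have husum := continuousOn_finsetSum Finset.univ fun i _ => h.continuousOn_input i
  unfold runningCost
  refine ((continuousOn_finsetSum _ fun i _ => ?_).add ?_).add ?_
  · exact (hc i).contDiff.continuous.comp_continuousOn (h.continuousOn_soc i)
  · exact hg.contDiff.continuous.comp_continuousOn ((hP.load.continuousOn.mono hs).sub hsum)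
  · exact ((husum.sub (hP.continuousOn_deriv_load.mono hs)).pow 2).const_mul _

theorem IsTrajectoryOn.intervalIntegrable (h : P.IsTrajectoryOn a b x z u)
    (hP : P.Regular) (hab : a ≤ b) (hs : Icc a b ⊆ Icc 0 P.T) :
    IntervalIntegrable (fun t => P.runningCost (x t) (z t) (u t) t) MeasureTheory.volume a b :=
  (h.continuousOn_runningCost hP hs).intervalIntegrable_of_Icc hab

theorem IsTrajectoryOn.integral_glue (h : P.IsTrajectoryOn a b x z u)
    (h' : P.IsTrajectoryOn b c x' z' u') (hP : P.Regular)
    (hab : a ≤ b) (hbc : b ≤ c) (hx : x b = x' b) (hz : z b = z' b) (hu : u b = u' b)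
    (h0 : 0 ≤ a) (hc : c ≤ P.T) :
    (∫ t in a..c, P.runningCost (if t ≤ b then x t else x' t) (if t ≤ b then z t else z' t)
        (if t ≤ b then u t else u' t) t) =
      (∫ t in a..b, P.runningCost (x t) (z t) (u t) t) +
        ∫ t in b..c, P.runningCost (x' t) (z' t) (u' t) t := by
  have hG := h.glue h' hab hbc hx hz hu
  have hi₁ := (hG.mono (Icc_subset_Icc_right hbc)).intervalIntegrable hP hab
    (Icc_subset_Icc h0 (hbc.trans hc))
  have hi₂ := (hG.mono (Icc_subset_Icc_left hab)).intervalIntegrable hP hbc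
    (Icc_subset_Icc (h0.trans hab) hc)
  rw [← intervalIntegral.integral_add_adjacent_intervals hi₁ hi₂]
  congr 1
  · refine intervalIntegral.integral_congr fun t ht => ?_
    rw [uIcc_of_le hab] at ht
    simp [ht.2]
  · refine intervalIntegral.integral_congr fun t ht => ?_
    rw [uIcc_of_le hbc] at ht
    rcases ht.1.eq_or_lt with rfl | hlt
    · simp [hx, hz, hu]
    · simp [not_le.2 hlt]

/-! ### Steering between states with equal aggregates -/

open Polynomial in
/-- Short connections of uniformly bounded cost: from any state with the same aggregates, and with
any initial input, a trajectory can be joined within time `h`. -/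
theorem IsTrajectoryOn.exists_connection {t₁ : ℝ} (h : P.IsTrajectoryOn t₁ P.T x z u)
    (hP : P.Regular) (h0 : 0 ≤ t₁) {p q ν : Fin M → ℝ}
    (hp : ∑ i, p i = ∑ i, x t₁ i) (hq : ∑ i, q i = ∑ i, z t₁ i) :
    ∃ C : ℝ, ∀ η : ℝ, 0 < η → η ≤ 1 → t₁ + η ≤ P.T → ∃ X Z U : ℝ → Fin M → ℝ,
      P.IsTrajectoryOn t₁ (t₁ + η) X Z U ∧ X t₁ = p ∧ Z t₁ = q ∧ U t₁ = ν ∧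
      X (t₁ + η) = x (t₁ + η) ∧ Z (t₁ + η) = z (t₁ + η) ∧ U (t₁ + η) = u (t₁ + η) ∧
      ∀ t ∈ Icc t₁ (t₁ + η), P.runningCost (X t) (Z t) (U t) t ≤ C := by
  obtain ⟨f, hf, a₁, a₂, a₃, b₁, b₂, b₃, c₁, c₂, c₃⟩ := exists_profiles
  -- At `σ = 0` the function `Y` and its time derivatives take the values `0`, `A`, `2B`, `6C`;
  -- these constants make the perturbed state and input start at `p`, `q`, `ν`.
  set A : Fin M → ℝ := fun i => p i - x t₁ i with hA
  set B : Fin M → ℝ := fun i => -(q i - z t₁ i) / 2 with hB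
  set C : Fin M → ℝ := fun i => (P.α i ^ 2 * A i - (ν i - u t₁ i)) / 6 with hC
  have hAs : ∑ i, A i = 0 := by simp [hA, hp]
  have hBs : ∑ i, B i = 0 := by simp [hB, ← Finset.sum_div, hq]
  set Y : ℝ → ℝ → Fin M → ℝ := fun η σ i =>
    A i * η * (f 0).eval σ + B i * η ^ 2 * (f 1).eval σ + C i * η ^ 3 * (f 2).eval σ with hY
  set Y₁ : ℝ → ℝ → Fin M → ℝ := fun η σ i =>
    A i * (derivative (f 0)).eval σ + B i * η * (derivative (f 1)).eval σ
      + C i * η ^ 2 * (derivative (f 2)).eval σ with hY₁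
  set Y₂ : ℝ → ℝ → Fin M → ℝ := fun η σ i =>
    A i * η⁻¹ * (derivative (derivative (f 0))).eval σ
      + B i * (derivative (derivative (f 1))).eval σ
      + C i * η * (derivative (derivative (f 2))).eval σ with hY₂
  set Y₃ : ℝ → ℝ → Fin M → ℝ := fun η σ i =>
    A i * η⁻¹ ^ 2 * (derivative (derivative (derivative (f 0)))).eval σ
      + B i * η⁻¹ * (derivative (derivative (derivative (f 1)))).eval σ
      + C i * (derivative (derivative (derivative (f 2)))).eval σ with hY₃
  -- The negative powers of `η` carry the factors `∑ A` and `∑ B`, which vanish because the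
  -- aggregates agree. Individual powers and inputs may blow up as `η → 0`, but their sums do not.
  have hYs : ∀ η σ, ∑ i, Y₂ η σ i = (∑ i, C i) * η * (derivative (derivative (f 2))).eval σ := by
    intro η σ
    simp only [hY₂, Finset.sum_add_distrib, ← Finset.sum_mul, hAs, hBs]
    ring
  have hYs' : ∀ η σ, ∑ i, Y₃ η σ i =
      (∑ i, C i) * (derivative (derivative (derivative (f 2)))).eval σ := by
    intro η σ
    simp only [hY₃, Finset.sum_add_distrib, ← Finset.sum_mul, hAs, hBs]
    ring
  obtain ⟨μ, -, hc, hg⟩ := hP.costs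
  -- The running cost of the connection as a function of `(t, η, σ)`, with the singular terms
  -- cancelled. It is continuous up to `η = 0`, so compactness gives a bound independent of `η`.
  set G : ℝ × ℝ × ℝ → ℝ := fun w =>
    (∑ i, P.c i (x w.1 i + (Y₁ w.2.1 w.2.2 i - P.α i * Y w.2.1 w.2.2 i)))
    + P.cg (P.ℓ w.1 - ((∑ i, z w.1 i) + (-((∑ i, C i) * w.2.1 *
        (derivative (derivative (f 2))).eval w.2.2) + ∑ i, P.α i ^ 2 * Y w.2.1 w.2.2 i)))
    + P.κ * (((∑ i, u w.1 i) + (-((∑ i, C i) *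
        (derivative (derivative (derivative (f 2)))).eval w.2.2)
          + ∑ i, P.α i ^ 2 * Y₁ w.2.1 w.2.2 i)) - derivWithin P.ℓ (Icc 0 P.T) w.1) ^ 2 with hGd
  set S : Set (ℝ × ℝ × ℝ) := Icc t₁ P.T ×ˢ Icc (0 : ℝ) 1 ×ˢ Icc (0 : ℝ) 1 with hS
  have hfst : MapsTo (fun w : ℝ × ℝ × ℝ => w.1) S (Icc t₁ P.T) := fun w hw => hw.1
  have hfst' : MapsTo (fun w : ℝ × ℝ × ℝ => w.1) S (Icc 0 P.T) :=
    fun w hw => ⟨h0.trans hw.1.1, hw.1.2⟩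
  have hcomp : ∀ {g : ℝ → ℝ}, ContinuousOn g (Icc t₁ P.T) →
      ContinuousOn (fun w : ℝ × ℝ × ℝ => g w.1) S :=
    fun hg => hg.comp continuousOn_fst hfst
  have hcomp' : ∀ {g : ℝ → ℝ}, ContinuousOn g (Icc 0 P.T) →
      ContinuousOn (fun w : ℝ × ℝ × ℝ => g w.1) S :=
    fun hg => hg.comp continuousOn_fst hfst'
  have hYc : ∀ i, Continuous fun w : ℝ × ℝ × ℝ => Y w.2.1 w.2.2 i := by
    intro i; simp only [hY]; fun_prop
  have hY₁c : ∀ i, Continuous fun w : ℝ × ℝ × ℝ => Y₁ w.2.1 w.2.2 i := by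
    intro i; simp only [hY₁]; fun_prop
  have hG : ContinuousOn G S := by
    refine ((continuousOn_finsetSum _ fun i _ => ?_).add ?_).add ?_
    · exact (hc i).contDiff.continuous.comp_continuousOn ((hcomp (h.continuousOn_soc i)).add
        ((hY₁c i).sub ((hYc i).const_mul _)).continuousOn)
    · refine hg.contDiff.continuous.comp_continuousOn ((hcomp' hP.load.continuousOn).sub
        ((continuousOn_finsetSum _ fun i _ => hcomp (h.continuousOn_power i)).add
          (Continuous.continuousOn ?_)))
      have := continuous_finsetSum Finset.univ fun i _ => (hYc i).const_mul (P.α i ^ 2)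
      fun_prop
    · refine ((((continuousOn_finsetSum _ fun i _ => hcomp (h.continuousOn_input i)).add
        (Continuous.continuousOn ?_)).sub (hcomp' hP.continuousOn_deriv_load)).pow 2).const_mul _
      have := continuous_finsetSum Finset.univ fun i _ => (hY₁c i).const_mul (P.α i ^ 2)
      fun_prop
  obtain ⟨K, hK⟩ := (isCompact_Icc.prod (isCompact_Icc.prod isCompact_Icc) :
    IsCompact S).exists_bound_of_continuousOn hG
  refine ⟨K, fun η hη hη1 hηT => ?_⟩
  have hσ : ∀ t, HasDerivAt (fun t => (t - t₁) / η) (η⁻¹) t := by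
    intro t
    simpa using ((hasDerivAt_id t).sub_const t₁).div_const η
  have hev : ∀ (r : ℝ[X]) (t : ℝ), HasDerivAt (fun t => r.eval ((t - t₁) / η))
      ((derivative r).eval ((t - t₁) / η) * η⁻¹) t :=
    fun r t => (r.hasDerivAt _).comp t (hσ t)
  have hη' : η ≠ 0 := hη.ne'
  have hpert := (h.mono (Icc_subset_Icc_right hηT)).add_perturbation
    (Y := fun t => Y η ((t - t₁) / η)) (Y₁ := fun t => Y₁ η ((t - t₁) / η))
    (Y₂ := fun t => Y₂ η ((t - t₁) / η)) (Y₃ := fun t => Y₃ η ((t - t₁) / η))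
    (fun t i => by
      refine ((((hev _ t).const_mul _).add ((hev _ t).const_mul _)).add
        ((hev _ t).const_mul _)).congr_deriv ?_
      simp only [hY₁]; field_simp)
    (fun t i => by
      refine ((((hev _ t).const_mul _).add ((hev _ t).const_mul _)).add
        ((hev _ t).const_mul _)).congr_deriv ?_
      simp only [hY₂]; field_simp)
    (fun t i => by
      refine ((((hev _ t).const_mul _).add ((hev _ t).const_mul _)).add
        ((hev _ t).const_mul _)).congr_deriv ?_
      simp only [hY₃]; field_simp)
    (fun i => by simp only [hY₃]; fun_prop)
  refine ⟨_, _, _, hpert, ?_, ?_, ?_, ?_, ?_, ?_, fun t ht => ?_⟩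
  · funext i; simp [hY, hY₁, hf, a₁, a₂, a₃, hA]
  · funext i; simp [hY, hY₂, hf, b₁, b₂, b₃, hB]
  · funext i; simp [hY₁, hY₃, a₁, a₂, a₃, c₁, c₂, c₃, hC]
  · funext i; simp [hY, hY₁, hf, hη']
  · funext i; simp [hY, hY₂, hf, hη']
  · funext i; simp [hY₁, hY₃, hf, hη']
  · have hmem : (t, η, (t - t₁) / η) ∈ S := by
      refine ⟨⟨ht.1, ht.2.trans hηT⟩, ⟨hη.le, hη1⟩, div_nonneg (sub_nonneg.2 ht.1) hη.le, ?_⟩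
      rw [div_le_one hη]
      linarith [ht.2]
    refine le_trans (le_of_eq ?_) ((le_abs_self _).trans (hK _ hmem))
    simp only [runningCost, hGd, Finset.sum_add_distrib, Finset.sum_neg_distrib, hYs, hYs']

/-- The state may be moved at negligible cost without changing the aggregates. -/
theorem IsTrajectoryOn.exists_steering {t₁ : ℝ} (h : P.IsTrajectoryOn t₁ P.T x z u)
    (hP : P.Regular) (h0 : 0 ≤ t₁) (h1 : t₁ < P.T) {p q : Fin M → ℝ} (ν : Fin M → ℝ)
    (hp : ∑ i, p i = ∑ i, x t₁ i) (hq : ∑ i, q i = ∑ i, z t₁ i) {ε : ℝ} (hε : 0 < ε) :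
    ∃ X Z U : ℝ → Fin M → ℝ, P.IsTrajectoryOn t₁ P.T X Z U ∧ X t₁ = p ∧ Z t₁ = q ∧ U t₁ = ν ∧
      P.cost t₁ X Z U ≤ P.cost t₁ x z u + ε := by
  obtain ⟨C, hC⟩ := h.exists_connection hP h0 (ν := ν) hp hq
  -- The connection costs at most `C * η ≤ ε`, and the initial piece of the old trajectory that it
  -- replaces has nonnegative cost.
  set η : ℝ := min 1 (min (P.T - t₁) (ε / (|C| + 1))) with hη
  have hη0 : 0 < η := lt_min one_pos (lt_min (sub_pos.2 h1) (by positivity))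
  have hηT : t₁ + η ≤ P.T := by
    have : η ≤ P.T - t₁ := (min_le_right _ _).trans (min_le_left _ _)
    linarith
  have hηε : C * η ≤ ε := by
    have h2 : η ≤ ε / (|C| + 1) := (min_le_right _ _).trans (min_le_right _ _)
    rw [le_div_iff₀ (by positivity)] at h2
    nlinarith [le_abs_self C]
  obtain ⟨X, Z, U, hT, hX, hZ, hU, eX, eZ, eU, hcost⟩ := hC η hη0 (min_le_left _ _) hηT
  have htail := h.mono (Icc_subset_Icc_left (le_add_of_nonneg_right hη0.le : t₁ ≤ t₁ + η))
  have hle : t₁ ≤ t₁ + η := by linarith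
  refine ⟨_, _, _, hT.glue htail hle hηT eX eZ eU, ?_, ?_, ?_, ?_⟩
  · simp [hη0.le, hX]
  · simp [hη0.le, hZ]
  · simp [hη0.le, hU]
  · unfold cost
    rw [hT.integral_glue htail hP hle hηT eX eZ eU h0 le_rfl]
    have i₁ := (h.mono (Icc_subset_Icc_right hηT)).intervalIntegrable hP hle
      (Icc_subset_Icc h0 hηT)
    have i₂ := htail.intervalIntegrable hP hηT (Icc_subset_Icc (h0.trans hle) le_rfl)
    rw [← intervalIntegral.integral_add_adjacent_intervals i₁ i₂]
    have n₁ : 0 ≤ ∫ t in t₁..(t₁ + η), P.runningCost (x t) (z t) (u t) t :=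
      intervalIntegral.integral_nonneg hle fun t _ => hP.runningCost_nonneg _ _ _ _
    have n₂ := intervalIntegral.integral_mono_on hle
      (hT.intervalIntegrable hP hle (Icc_subset_Icc h0 hηT))
      (intervalIntegrable_const (c := C)) hcost
    rw [intervalIntegral.integral_const, smul_eq_mul] at n₂
    linarith

/-! ### Comparison of the two value functions -/

theorem exists_isAdmissible (P : Model M) (t₀ : ℝ) (p q : Fin M → ℝ) :
    ∃ x z u, P.IsAdmissible t₀ p q x z u := by
  have hx : ∀ i t, HasDerivAt (fun t => p i + (-P.α i * p i - q i) * (t - t₀))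
      (-P.α i * p i - q i) t := by
    intro i t
    simpa using (((hasDerivAt_id t).sub_const t₀).const_mul (-P.α i * p i - q i)).const_add (p i)
  refine ⟨fun t i => p i + (-P.α i * p i - q i) * (t - t₀),
    fun t i => -(-P.α i * p i - q i) - P.α i * (p i + (-P.α i * p i - q i) * (t - t₀)),
    fun _ i => -(P.α i * (-P.α i * p i - q i)), continuousOn_const, fun t _ i => ?_,
    fun t _ i => ?_, ?_, ?_⟩
  · refine ((hx i t).congr_deriv ?_).hasDerivWithinAt
    ring
  · exact (((hx i t).const_mul (P.α i)).const_sub _).hasDerivWithinAt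
  · funext i; simp
  · funext i; simp

theorem Regular.cost_nonneg (hP : P.Regular) {t₀ : ℝ} (h : t₀ ≤ P.T) (x z u : ℝ → Fin M → ℝ) :
    0 ≤ P.cost t₀ x z u :=
  intervalIntegral.integral_nonneg h fun _ _ => hP.runningCost_nonneg _ _ _ _

theorem Regular.J_le_cost (hP : P.Regular) {t₀ : ℝ} (h : t₀ ≤ P.T) {p q : Fin M → ℝ}
    (hx : P.IsAdmissible t₀ p q x z u) : P.J p q t₀ ≤ P.cost t₀ x z u := by
  refine csInf_le ⟨0, ?_⟩ ⟨x, z, u, hx, rfl⟩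
  rintro v ⟨x, z, u, -, rfl⟩
  exact hP.cost_nonneg h x z u

/-- Holds for every real `v` only because admissible trajectories exist: the infimum of the empty
set would be the default value `0`. -/
theorem le_J {t₀ v : ℝ} {p q : Fin M → ℝ}
    (h : ∀ x z u, P.IsAdmissible t₀ p q x z u → v ≤ P.cost t₀ x z u) : v ≤ P.J p q t₀ := by
  obtain ⟨x, z, u, hx⟩ := P.exists_isAdmissible t₀ p q
  refine le_csInf ⟨_, x, z, u, hx, rfl⟩ ?_
  rintro w ⟨x, z, u, hx, rfl⟩
  exact h x z u hx

theorem Regular.K_le_J (hP : P.Regular) {t₀ : ℝ} (h : t₀ ≤ P.T) (p q : Fin M → ℝ) :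
    P.K (∑ i, p i) (∑ i, q i) t₀ ≤ P.J p q t₀ := by
  refine csInf_le ⟨0, ?_⟩ ⟨p, q, rfl, rfl, rfl⟩
  rintro v ⟨p, q, -, -, rfl⟩
  exact le_J fun x z u _ => hP.cost_nonneg h x z u

theorem le_K {t₀ v : ℝ} {p q : Fin M → ℝ}
    (h : ∀ p' q' : Fin M → ℝ, ∑ i, p' i = ∑ i, p i → ∑ i, q' i = ∑ i, q i →
      v ≤ P.J p' q' t₀) : v ≤ P.K (∑ i, p i) (∑ i, q i) t₀ := by
  refine le_csInf ⟨_, p, q, rfl, rfl, rfl⟩ ?_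
  rintro w ⟨p', q', h₁, h₂, rfl⟩
  exact h p' q' h₁ h₂

/-- The cost-to-go depends on the state only through the aggregates. -/
theorem Regular.J_le_K (hP : P.Regular) {t₀ : ℝ} (h0 : 0 ≤ t₀) (h1 : t₀ < P.T)
    (p q : Fin M → ℝ) : P.J p q t₀ ≤ P.K (∑ i, p i) (∑ i, q i) t₀ := by
  refine le_K fun p' q' hp hq => le_J fun x z u hx => le_of_forall_pos_le_add fun ε hε => ?_
  obtain ⟨X, Z, U, hT, rfl, rfl, -, hc⟩ := hx.isTrajectoryOn.exists_steering hP h0 h1 (p := p)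
    (q := q) 0 (by rw [hx.init_soc, hp]) (by rw [hx.init_power, hq]) hε
  exact (hP.J_le_cost h1.le hT.isAdmissible).trans hc

/-- One half of the principle of optimality. -/
theorem IsTrajectoryOn.K_le_add_K (h : P.IsTrajectoryOn a b x z u) (hP : P.Regular)
    (h0 : 0 ≤ a) (hab : a ≤ b) (hb : b < P.T) :
    P.K (∑ i, x a i) (∑ i, z a i) a ≤
      (∫ t in a..b, P.runningCost (x t) (z t) (u t) t) + P.K (∑ i, x b i) (∑ i, z b i) b := by
  rw [← sub_le_iff_le_add']
  refine le_K fun p' q' hp hq => le_J fun x' z' u' hx => le_of_forall_pos_le_add fun ε hε => ?_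
  -- The near-optimal continuation is modified to start at `x b`, `z b` with input `u b`: admissible
  -- inputs are continuous, so the input has to match as well.
  obtain ⟨X, Z, U, hT, hX, hZ, hU, hc⟩ := hx.isTrajectoryOn.exists_steering hP (h0.trans hab) hb
    (p := x b) (q := z b) (u b) (by rw [hx.init_soc, hp]) (by rw [hx.init_power, hq]) hε
  have hG := h.glue hT hab hb.le hX.symm hZ.symm hU.symm
  have h2 := hP.J_le_cost (hab.trans hb.le) hG.isAdmissible
  have h3 := (hP.K_le_J (hab.trans hb.le) _ _).trans h2
  unfold cost at h3 hc ⊢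
  rw [h.integral_glue hT hP hab hb.le hX.symm hZ.symm hU.symm h0 le_rfl] at h3
  simp only [hab, if_true] at h3
  linarith

/-! ### Regularity of the marginal value and of the state up to the jump time -/

variable {x₀ z₀ : Fin M → ℝ}

theorem uniqueDiffOn_valueDomain (hT : 0 < P.T) :
    UniqueDiffOn ℝ ((univ : Set ℝ) ×ˢ (univ : Set ℝ) ×ˢ Icc 0 P.T) :=
  uniqueDiffOn_univ.prod (uniqueDiffOn_univ.prod (uniqueDiffOn_Icc hT))

theorem SmoothValue.hasDerivAt_fderivWithin (hV : P.SmoothValue) (r s : ℝ) {t : ℝ}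
    (ht : t ∈ Icc 0 P.T) :
    HasDerivAt (fun r' => P.K r' s t)
      (fderivWithin ℝ (fun p : ℝ × ℝ × ℝ => P.K p.1 p.2.1 p.2.2)
        (univ ×ˢ univ ×ˢ Icc 0 P.T) (r, s, t) (1, 0, 0)) r := by
  have h := (hV.differentiableOn one_ne_zero (r, s, t)
    ⟨mem_univ _, mem_univ _, ht⟩).hasFDerivWithinAt
  have hl : HasDerivAt (fun r' : ℝ => (r', s, t)) ((1 : ℝ), (0 : ℝ), (0 : ℝ)) r :=
    (hasDerivAt_id r).prodMk (hasDerivAt_const r (s, t))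
  have hm : MapsTo (fun r' : ℝ => (r', s, t)) univ
      ((univ : Set ℝ) ×ˢ (univ : Set ℝ) ×ˢ Icc 0 P.T) :=
    fun r' _ => ⟨mem_univ _, mem_univ _, ht⟩
  have := h.comp_hasDerivWithinAt r hl.hasDerivWithinAt hm
  rwa [hasDerivWithinAt_univ] at this

theorem SmoothValue.hasDerivAt (hV : P.SmoothValue) (r s : ℝ) {t : ℝ} (ht : t ∈ Icc 0 P.T) :
    HasDerivAt (fun r' => P.K r' s t) (P.K100 r s t) r :=
  (hV.hasDerivAt_fderivWithin r s ht).differentiableAt.hasDerivAt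

theorem SmoothValue.continuousOn_K100 (hV : P.SmoothValue) (hT : 0 < P.T) :
    ContinuousOn (fun p : ℝ × ℝ × ℝ => P.K100 p.1 p.2.1 p.2.2) (univ ×ˢ univ ×ˢ Icc 0 P.T) := by
  refine ((hV.continuousOn_fderivWithin (uniqueDiffOn_valueDomain hT) le_rfl).clm_apply
    (continuousOn_const (c := ((1 : ℝ), (0 : ℝ), (0 : ℝ))))).congr fun p hp => ?_
  exact (hV.hasDerivAt_fderivWithin p.1 p.2.1 hp.2.2).deriv

namespace IsPostJumpTrajectory

theorem isTrajectoryOn (h : P.IsPostJumpTrajectory 0 x₀ z₀ x z u) {a b : ℝ} (ha : 0 < a)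
    (hb : b ≤ P.T) : P.IsTrajectoryOn a b x z u := by
  have hs : Icc a b ⊆ Ioc 0 P.T := fun t ht => ⟨ha.trans_le ht.1, ht.2.trans hb⟩
  exact ⟨h.input_cont.mono hs, fun t ht i => (h.soc t (hs ht) i).mono hs,
    fun t ht i => (h.ramp t (hs ht) i).mono hs⟩

theorem nhdsWithin_Icc_eq {T t : ℝ} (ht : 0 < t) : 𝓝[Icc 0 T] t = 𝓝[Ioc 0 T] t := by
  refine nhdsWithin_eq_nhdsWithin (mem_Ioi.2 ht) isOpen_Ioi ?_
  ext s
  exact ⟨fun h => ⟨⟨h.2, h.1.2⟩, h.2⟩, fun h => ⟨⟨h.1.1.le, h.1.2⟩, h.2⟩⟩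

theorem continuousOn_soc (h : P.IsPostJumpTrajectory 0 x₀ z₀ x z u) (i : Fin M) :
    ContinuousOn (fun t => x t i) (Icc 0 P.T) := by
  intro t ht
  rcases ht.1.eq_or_lt with rfl | h0
  · have := continuousWithinAt_Ioi_iff_Ici.1
      (tendsto_pi_nhds.1 h.limit_soc i : ContinuousWithinAt (fun t => x t i) (Ioi 0) 0)
    exact this.mono Icc_subset_Ici_self
  · have := (h.soc t ⟨h0, ht.2⟩ i).continuousWithinAt
    rwa [ContinuousWithinAt, ← nhdsWithin_Icc_eq h0] at this

theorem continuousOn_power (h : P.IsPostJumpTrajectory 0 x₀ z₀ x z u) (i : Fin M) :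
    ContinuousOn (fun t => z t i) (Icc 0 P.T) := by
  intro t ht
  rcases ht.1.eq_or_lt with rfl | h0
  · have := continuousWithinAt_Ioi_iff_Ici.1
      (tendsto_pi_nhds.1 h.limit_power i : ContinuousWithinAt (fun t => z t i) (Ioi 0) 0)
    exact this.mono Icc_subset_Ici_self
  · have := (h.ramp t ⟨h0, ht.2⟩ i).continuousWithinAt
    rwa [ContinuousWithinAt, ← nhdsWithin_Icc_eq h0] at this

/-- At the jump time the state equation survives because its right-hand side, the derivative of `x`,
has a limit there. No such claim is possible for `z`, since `u` need not have a limit at `0`. -/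
theorem hasDerivWithinAt_soc (h : P.IsPostJumpTrajectory 0 x₀ z₀ x z u) (hT : 0 < P.T)
    (i : Fin M) {t : ℝ} (ht : t ∈ Icc 0 P.T) :
    HasDerivWithinAt (fun s => x s i) (-P.α i * x t i - z t i) (Icc 0 P.T) t := by
  rcases ht.1.eq_or_lt with rfl | h0
  · have hd : ∀ s ∈ Ioo 0 P.T, HasDerivAt (fun s => x s i) (-P.α i * x s i - z s i) s :=
      fun s hs => (h.soc s ⟨hs.1, hs.2.le⟩ i).hasDerivAt (Ioc_mem_nhds hs.1 hs.2)
    have hm : Ioo 0 P.T ∈ 𝓝[>] (0 : ℝ) := Ioo_mem_nhdsGT hT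
    refine (hasDerivWithinAt_Ici_of_tendsto_deriv (s := Ioo 0 P.T)
      (fun s hs => (hd s hs).differentiableAt.differentiableWithinAt)
      ((h.continuousOn_soc i 0 ht).mono Ioo_subset_Icc_self) hm ?_).mono Icc_subset_Ici_self
    have h1 : Tendsto (fun s => -P.α i * x s i - z s i) (𝓝[>] 0)
        (𝓝 (-P.α i * x 0 i - z 0 i)) :=
      ((tendsto_pi_nhds.1 h.limit_soc i).const_mul _).sub (tendsto_pi_nhds.1 h.limit_power i)
    refine h1.congr' ?_
    filter_upwards [hm] with s hs
    exact (hd s hs).deriv.symm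
  · have := h.soc t ⟨h0, ht.2⟩ i
    rwa [HasDerivWithinAt, HasDerivAtFilter, nhdsWithin_Icc_eq h0]

theorem continuousOn_comp_aggregates (h : P.IsPostJumpTrajectory 0 x₀ z₀ x z u)
    {f : ℝ → ℝ → ℝ → ℝ} (hf : ContinuousOn (fun p : ℝ × ℝ × ℝ => f p.1 p.2.1 p.2.2)
      (univ ×ˢ univ ×ˢ Icc 0 P.T)) :
    ContinuousOn (fun t => f (∑ i, x t i) (∑ i, z t i) t) (Icc 0 P.T) := by
  have hx : ContinuousOn (fun t => ∑ i, x t i) (Icc 0 P.T) :=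
    continuousOn_finsetSum _ fun i _ => h.continuousOn_soc i
  have hz : ContinuousOn (fun t => ∑ i, z t i) (Icc 0 P.T) :=
    continuousOn_finsetSum _ fun i _ => h.continuousOn_power i
  have key : ∀ r s : ℝ → ℝ, ContinuousOn r (Icc 0 P.T) → ContinuousOn s (Icc 0 P.T) →
      ContinuousOn (fun t => f (r t) (s t) t) (Icc 0 P.T) := fun r s hr hs =>
    hf.comp (f := fun t => (r t, s t, t)) (hr.prodMk (hs.prodMk continuousOn_id))
      fun t ht => ⟨mem_univ _, mem_univ _, ht⟩
  exact key _ _ hx hz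

theorem continuousOn_marginal (h : P.IsPostJumpTrajectory 0 x₀ z₀ x z u) (hT : 0 < P.T)
    (hV : P.SmoothValue) : ContinuousOn (P.marginal x z) (Icc 0 P.T) :=
  h.continuousOn_comp_aggregates (hV.continuousOn_K100 hT)

end IsPostJumpTrajectory

/-! ### Optimality of tails and the envelope argument -/

/-- The tail of an optimal solution is optimal. -/
theorem IsOptimal.cost_tail_eq (h : P.IsOptimal 0 x₀ z₀ x z u) (hP : P.Regular)
    (hV : P.SmoothValue) {τ : ℝ} (h0 : 0 < τ) (hτ : τ < P.T) :
    P.cost τ x z u = P.K (∑ i, x τ i) (∑ i, z τ i) τ := by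
  have hT := hP.horizon_pos
  have htr := h.trajectory
  have hτm : τ ∈ Icc 0 P.T := ⟨h0.le, hτ.le⟩
  refine le_antisymm ?_ ((hP.K_le_J hτ.le _ _).trans
    (hP.J_le_cost hτ.le (htr.isTrajectoryOn h0 le_rfl).isAdmissible))
  have i₁ : IntervalIntegrable (fun t => P.runningCost (x t) (z t) (u t) t)
      MeasureTheory.volume 0 τ :=
    h.integrable.mono_set (by rw [uIcc_of_le h0.le, uIcc_of_le hT.le]
                              exact Icc_subset_Icc_right hτ.le)
  have i₂ : IntervalIntegrable (fun t => P.runningCost (x t) (z t) (u t) t)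
      MeasureTheory.volume τ P.T :=
    h.integrable.mono_set (by rw [uIcc_of_le hτ.le, uIcc_of_le hT.le]
                              exact Icc_subset_Icc_left h0.le)
  -- The solution need not be admissible on `[0, T]`, as `u` may be singular at `0`. The principle
  -- of optimality is used from `δ > 0`, and `δ → 0` by continuity of `K`.
  have hbound : ∀ δ ∈ Ioo 0 τ, P.K (∑ i, x δ i) (∑ i, z δ i) δ ≤
      (∫ t in (0 : ℝ)..τ, P.runningCost (x t) (z t) (u t) t) +
        P.K (∑ i, x τ i) (∑ i, z τ i) τ := by
    intro δ hδ
    refine ((htr.isTrajectoryOn hδ.1 hτ.le).K_le_add_K hP hδ.1.le hδ.2.le hτ).trans ?_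
    gcongr
    exact intervalIntegral.integral_mono_interval hδ.1.le hδ.2.le le_rfl
      (Eventually.of_forall fun t => hP.runningCost_nonneg _ _ _ _) i₁
  have hKc : ContinuousOn (fun t => P.K (∑ i, x t i) (∑ i, z t i) t) (Icc 0 P.T) :=
    htr.continuousOn_comp_aggregates hV.continuousOn
  have hlim : Tendsto (fun t => P.K (∑ i, x t i) (∑ i, z t i) t) (𝓝[Ioo 0 τ] 0)
      (𝓝 (P.K (∑ i, x 0 i) (∑ i, z 0 i) 0)) :=
    (hKc 0 ⟨le_rfl, hT.le⟩).mono fun t ht => ⟨ht.1.le, ht.2.le.trans hτ.le⟩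
  have : (𝓝[Ioo 0 τ] (0 : ℝ)).NeBot := left_nhdsWithin_Ioo_neBot h0
  have h1 := le_of_tendsto hlim (eventually_nhdsWithin_of_forall hbound)
  have h2 := hP.J_le_K le_rfl hT x₀ z₀
  rw [← h.attains, ← htr.sum_soc, ← htr.sum_power] at h2
  unfold cost at h2 ⊢
  rw [← intervalIntegral.integral_add_adjacent_intervals i₁ i₂] at h2
  linarith

/-- Perturbing the initial state of charge and keeping the input. -/
theorem IsTrajectoryOn.add_free (P : Model M) {a b : ℝ} (h : P.IsTrajectoryOn a b x z u)
    (d : Fin M → ℝ) (ε : ℝ) :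
    P.IsTrajectoryOn a b (fun t i => x t i + ε * (d i * Real.exp (-P.α i * (t - a)))) z u := by
  refine ⟨h.input_cont, fun t ht i => ?_, h.ramp⟩
  have h1 : HasDerivAt (fun t => ε * (d i * Real.exp (-P.α i * (t - a))))
      (ε * (d i * (Real.exp (-P.α i * (t - a)) * (-P.α i)))) t := by
    have := (((hasDerivAt_id t).sub_const a).const_mul (-P.α i)).exp
    simpa using (this.const_mul (d i)).const_mul ε
  refine ((h.soc t ht i).add h1.hasDerivWithinAt).congr_deriv ?_
  ring

/-- Differentiation under the integral sign. Only the state-of-charge costs vary with `ε`, and the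
`ε`-derivative of the integrand is bounded on the compact set `[-1, 1] × [a, T]`. -/
theorem IsTrajectoryOn.hasDerivAt_cost_add_free {a : ℝ} (h : P.IsTrajectoryOn a P.T x z u)
    (hP : P.Regular) (h0 : 0 ≤ a) (ha : a ≤ P.T) (d : Fin M → ℝ) :
    HasDerivAt (fun ε => P.cost a
        (fun t i => x t i + ε * (d i * Real.exp (-P.α i * (t - a)))) z u)
      (∫ t in a..P.T, ∑ i, deriv (P.c i) (x t i) * (d i * Real.exp (-P.α i * (t - a)))) 0 := by
  set e : ℝ → Fin M → ℝ := fun t i => d i * Real.exp (-P.α i * (t - a)) with he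
  have hec : ∀ i, Continuous fun t => e t i := fun i => by simp only [he]; fun_prop
  have hsub : Icc a P.T ⊆ Icc 0 P.T := Icc_subset_Icc_left h0
  have hc' : ∀ i, Continuous (deriv (P.c i)) :=
    fun i => (hP.contDiff_cost i).continuous_deriv (by norm_num)
  set F' : ℝ → ℝ → ℝ := fun ε t => ∑ i, deriv (P.c i) (x t i + ε * e t i) * e t i with hF'
  have hF'c : ContinuousOn (fun w : ℝ × ℝ => F' w.1 w.2) (Icc (-1) 1 ×ˢ Icc a P.T) := by
    refine continuousOn_finsetSum _ fun i _ => ?_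
    have hx : ContinuousOn (fun w : ℝ × ℝ => x w.2 i) (Icc (-1) 1 ×ˢ Icc a P.T) :=
      (h.continuousOn_soc i).comp continuousOn_snd fun w hw => hw.2
    have he' : Continuous fun w : ℝ × ℝ => e w.2 i := (hec i).comp continuous_snd
    exact ((hc' i).comp_continuousOn
      (hx.add (continuous_fst.mul he').continuousOn)).mul he'.continuousOn
  obtain ⟨C, hC⟩ := (isCompact_Icc.prod isCompact_Icc).exists_bound_of_continuousOn hF'c
  have hint : ∀ ε, IntervalIntegrable
      (fun t => P.runningCost (fun i => x t i + ε * e t i) (z t) (u t) t)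
      MeasureTheory.volume a P.T :=
    fun ε => (IsTrajectoryOn.add_free P h d ε).intervalIntegrable hP ha hsub
  have hF'0 : ContinuousOn (F' 0) (Icc a P.T) :=
    hF'c.comp (f := fun t : ℝ => ((0 : ℝ), t)) (by fun_prop)
      fun t ht => ⟨by norm_num, ht⟩
  have hdiff : ∀ ε t, HasDerivAt
      (fun ε => P.runningCost (fun i => x t i + ε * e t i) (z t) (u t) t) (F' ε t) ε := by
    intro ε t
    unfold runningCost
    refine HasDerivAt.add_const _ (HasDerivAt.add_const _ (HasDerivAt.fun_sum fun i _ => ?_))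
    have h1 : HasDerivAt (P.c i) (deriv (P.c i) (x t i + ε * e t i)) (x t i + ε * e t i) :=
      ((hP.contDiff_cost i).differentiable (by norm_num) _).hasDerivAt
    have h2 : HasDerivAt (fun ε => x t i + ε * e t i) (e t i) ε := by
      simpa using ((hasDerivAt_id ε).mul_const (e t i)).const_add (x t i)
    exact h1.comp ε h2
  have key := intervalIntegral.hasDerivAt_integral_of_dominated_loc_of_deriv_le
    (μ := MeasureTheory.volume) (a := a) (b := P.T) (x₀ := (0 : ℝ)) (bound := fun _ => C)
    (s := Icc (-1) 1)
    (F := fun ε t => P.runningCost (fun i => x t i + ε * e t i) (z t) (u t) t) (F' := F')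
    (Icc_mem_nhds (by norm_num) (by norm_num))
    (Eventually.of_forall fun ε => ((intervalIntegrable_iff).1 (hint ε)).aestronglyMeasurable)
    (hint 0)
    ((intervalIntegrable_iff).1 (hF'0.intervalIntegrable_of_Icc ha)).aestronglyMeasurable
    (Eventually.of_forall fun t ht ε hε => hC (ε, t)
      ⟨hε, by rw [uIoc_of_le ha] at ht; exact Ioc_subset_Icc_self ht⟩)
    intervalIntegrable_const
    (Eventually.of_forall fun t _ ε _ => hdiff ε t)
  refine key.2.congr_deriv (intervalIntegral.integral_congr fun t _ => ?_)
  simp only [hF', he, zero_mul, add_zero]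

/-- Integral representation of the marginal value along an optimal solution. -/
theorem IsOptimal.marginal_eq_integral (h : P.IsOptimal 0 x₀ z₀ x z u) (hP : P.Regular)
    (hV : P.SmoothValue) (i : Fin M) {τ : ℝ} (h0 : 0 < τ) (hτ : τ < P.T) :
    P.marginal x z τ =
      ∫ t in τ..P.T, deriv (P.c i) (x t i) * Real.exp (-P.α i * (t - τ)) := by
  have htr := h.trajectory.isTrajectoryOn h0 le_rfl
  have hF := htr.hasDerivAt_cost_add_free hP h0.le hτ.le (Pi.single i 1)
  have hK : HasDerivAt (fun ε => P.K (∑ j, x τ j + ε) (∑ j, z τ j) τ) (P.marginal x z τ) 0 := by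
    have := hV.hasDerivAt (∑ j, x τ j + 0) (∑ j, z τ j) (t := τ) ⟨h0.le, hτ.le⟩
    simpa [marginal] using this.comp_const_add (∑ j, x τ j) 0
  have hle : ∀ ε, P.K (∑ j, x τ j + ε) (∑ j, z τ j) τ ≤ P.cost τ
      (fun t j => x t j + ε * ((Pi.single i 1 : Fin M → ℝ) j
        * Real.exp (-P.α j * (t - τ)))) z u := by
    intro ε
    have hT := IsTrajectoryOn.add_free P htr (Pi.single i 1) ε
    have := (hP.K_le_J hτ.le _ _).trans (hP.J_le_cost hτ.le hT.isAdmissible)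
    simpa [Finset.sum_add_distrib, ← Finset.mul_sum] using this
  -- Value minus cost is nonpositive and vanishes at `ε = 0`, so its derivative there is zero.
  have hmax : IsLocalMax (fun ε => P.K (∑ j, x τ j + ε) (∑ j, z τ j) τ - P.cost τ
      (fun t j => x t j + ε * ((Pi.single i 1 : Fin M → ℝ) j
        * Real.exp (-P.α j * (t - τ)))) z u) 0 := by
    refine Eventually.of_forall fun ε => ?_
    have h1 := hle ε
    have h2 := h.cost_tail_eq hP hV h0 hτ
    simp only [zero_mul, add_zero, h2, sub_self]
    linarith
  have := hmax.hasDerivAt_eq_zero (hK.sub hF)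
  rw [sub_eq_zero.1 this]
  refine intervalIntegral.integral_congr fun t _ => ?_
  rw [Finset.sum_eq_single i (fun j _ hj => by simp [hj]) (by simp)]
  simp

/-! ### The costate equation and its consequences -/

/-- The costate equation for the marginal value. -/
theorem IsOptimal.hasDerivWithinAt_marginal (h : P.IsOptimal 0 x₀ z₀ x z u) (hP : P.Regular)
    (hV : P.SmoothValue) (i : Fin M) {τ : ℝ} (hτ : τ ∈ Icc 0 P.T) :
    HasDerivWithinAt (P.marginal x z) (P.α i * P.marginal x z τ - deriv (P.c i) (x τ i))
      (Icc 0 P.T) τ := by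
  have hT := hP.horizon_pos
  have hc' : Continuous (deriv (P.c i)) := (hP.contDiff_cost i).continuous_deriv (by norm_num)
  -- Clamping time to `[0, T]` makes the integrand continuous on the whole line, so that the
  -- fundamental theorem of calculus also applies at the end points.
  set g : ℝ → ℝ := fun t => deriv (P.c i) (x (projIcc 0 P.T hT.le t) i) *
    Real.exp (-P.α i * t) with hg
  have hgc : Continuous g :=
    (hc'.comp ((h.trajectory.continuousOn_soc i).comp_continuous
      (continuous_subtype_val.comp continuous_projIcc)
      fun t => (projIcc 0 P.T hT.le t).2)).mul (by fun_prop)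
  set Λ : ℝ → ℝ := fun τ => Real.exp (P.α i * τ) * ∫ t in τ..P.T, g t with hΛ
  have hΛd : ∀ τ, HasDerivAt Λ (P.α i * Λ τ - Real.exp (P.α i * τ) * g τ) τ := by
    intro τ
    have h1 : HasDerivAt (fun τ => Real.exp (P.α i * τ)) (Real.exp (P.α i * τ) * P.α i) τ := by
      simpa using ((hasDerivAt_id τ).const_mul (P.α i)).exp
    have h2 := intervalIntegral.integral_hasDerivAt_left (hgc.intervalIntegrable τ P.T)
      (hgc.stronglyMeasurableAtFilter _ _) hgc.continuousAt
    refine (h1.mul h2).congr_deriv ?_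
    simp only [hΛ]; ring
  have hIoo : EqOn (P.marginal x z) Λ (Ioo 0 P.T) := by
    intro τ hτ
    rw [h.marginal_eq_integral hP hV i hτ.1 hτ.2]
    simp only [hΛ]
    rw [← intervalIntegral.integral_const_mul]
    refine intervalIntegral.integral_congr fun t ht => ?_
    rw [uIcc_of_le hτ.2.le] at ht
    simp only [hg]
    rw [projIcc_of_mem hT.le ⟨hτ.1.le.trans ht.1, ht.2⟩, mul_left_comm, ← Real.exp_add]
    ring_nf
  have hIcc : EqOn (P.marginal x z) Λ (Icc 0 P.T) :=
    hIoo.of_subset_closure (h.trajectory.continuousOn_marginal hT hV)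
      (fun t _ => (hΛd t).continuousAt.continuousWithinAt) Ioo_subset_Icc_self
      (closure_Ioo hT.ne).ge
  refine ((hΛd τ).hasDerivWithinAt.congr hIcc (hIcc hτ)).congr_deriv ?_
  have hgτ : Real.exp (P.α i * τ) * g τ = deriv (P.c i) (x τ i) := by
    simp only [hg]
    rw [projIcc_of_mem hT.le hτ, mul_left_comm, ← Real.exp_add]
    simp
  rw [hIcc hτ, hgτ]

/-- The derivative of the costate equation. -/
theorem IsOptimal.hasDerivWithinAt_marginal_deriv (h : P.IsOptimal 0 x₀ z₀ x z u)
    (hP : P.Regular) (hV : P.SmoothValue) (i : Fin M) {τ : ℝ} (hτ : τ ∈ Icc 0 P.T) :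
    HasDerivWithinAt (fun t => P.α i * P.marginal x z t - deriv (P.c i) (x t i))
      (P.α i * (P.α i * P.marginal x z τ - deriv (P.c i) (x τ i))
        - deriv (deriv (P.c i)) (x τ i) * (-P.α i * x τ i - z τ i)) (Icc 0 P.T) τ := by
  have hd : HasDerivAt (deriv (P.c i)) (deriv (deriv (P.c i)) (x τ i)) (x τ i) :=
    ((hP.contDiff_cost i).differentiable_deriv_two _).hasDerivAt
  have hx := h.trajectory.hasDerivWithinAt_soc hP.horizon_pos i hτ
  exact ((h.hasDerivWithinAt_marginal hP hV i hτ).const_mul _).sub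
    (hd.comp_hasDerivWithinAt (h := fun s => x s i) τ hx)

/-- A single class suffices: its costate equation expresses `λ'`, and then `λ''`, through `λ`, `x_i`
and `z_i`, all continuous on the closed interval. -/
theorem IsOptimal.contDiffOn_marginal (h : P.IsOptimal 0 x₀ z₀ x z u) (hP : P.Regular)
    (hV : P.SmoothValue) (i : Fin M) : ContDiffOn ℝ 2 (P.marginal x z) (Icc 0 P.T) := by
  have hT := hP.horizon_pos
  have hU := uniqueDiffOn_Icc hT
  have htr := h.trajectory
  have hc1 : Continuous (deriv (P.c i)) := (hP.contDiff_cost i).continuous_deriv (by norm_num)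
  have hc2 : Continuous (deriv (deriv (P.c i))) :=
    (contDiff_one_iff_deriv.1 (contDiff_succ_iff_deriv (n := 1).1 (hP.contDiff_cost i)).2.2).2
  have e1 : EqOn (derivWithin (P.marginal x z) (Icc 0 P.T))
      (fun t => P.α i * P.marginal x z t - deriv (P.c i) (x t i)) (Icc 0 P.T) :=
    fun t ht => (h.hasDerivWithinAt_marginal hP hV i ht).derivWithin (hU t ht)
  rw [show (2 : WithTop ℕ∞) = 1 + 1 from one_add_one_eq_two.symm,
    contDiffOn_succ_iff_derivWithin hU]
  refine ⟨fun t ht => (h.hasDerivWithinAt_marginal hP hV i ht).differentiableWithinAt,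
    by simp, ContDiffOn.congr ?_ e1⟩
  rw [contDiffOn_one_iff_derivWithin hU]
  refine ⟨fun t ht => (h.hasDerivWithinAt_marginal_deriv hP hV i ht).differentiableWithinAt,
    ContinuousOn.congr ?_ fun t ht =>
      (h.hasDerivWithinAt_marginal_deriv hP hV i ht).derivWithin (hU t ht)⟩
  have hx := htr.continuousOn_soc i
  have hz := htr.continuousOn_power i
  have hm := htr.continuousOn_marginal hT hV
  exact (((hm.const_mul _).sub (hc1.comp_continuousOn hx)).const_mul _).sub
    ((hc2.comp_continuousOn hx).mul ((hx.const_mul _).sub hz))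

end Model

end DemandDispatch

theorem mainTheorem7 {M : ℕ} (hM : 1 ≤ M) (P : DemandDispatch.Model M)
    (hA1 : P.Regular) (hA2 : P.UniquelySolvable) (hA3 : P.SmoothValue)
    (x₀ z₀ : Fin M → ℝ) (x z u : ℝ → Fin M → ℝ)
    (hopt : P.IsOptimal 0 x₀ z₀ x z u)
    (hA4 : ContDiffOn ℝ 2 (P.marginal x z) (Set.Ioc 0 P.T)) :
    ContDiffOn ℝ 2 (P.marginal x z) (Set.Icc 0 P.T) ∧
    ∀ i : Fin M,
      deriv (P.c i) (x 0 i) =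
          P.α i * P.K100 (∑ j, x 0 j) (∑ j, z 0 j) 0
            - derivWithin (P.marginal x z) (Set.Icc 0 P.T) 0 ∧
      z 0 i = -P.α i * x 0 i
          - 1 / deriv (deriv (P.c i)) (x 0 i) *
            (P.α i * derivWithin (P.marginal x z) (Set.Icc 0 P.T) 0
              - iteratedDerivWithin 2 (P.marginal x z) (Set.Icc 0 P.T) 0) := by
  refine ⟨hopt.contDiffOn_marginal hA1 hA3 ⟨0, hM⟩, fun i => ?_⟩
  have hU := uniqueDiffOn_Icc hA1.horizon_pos
  have hmem : (0 : ℝ) ∈ Set.Icc 0 P.T := ⟨le_rfl, hA1.horizon_pos.le⟩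
  have e1 : Set.EqOn (derivWithin (P.marginal x z) (Set.Icc 0 P.T))
      (fun t => P.α i * P.marginal x z t - deriv (P.c i) (x t i)) (Set.Icc 0 P.T) :=
    fun t ht => (hopt.hasDerivWithinAt_marginal hA1 hA3 i ht).derivWithin (hU t ht)
  have e2 : iteratedDerivWithin 2 (P.marginal x z) (Set.Icc 0 P.T) 0 =
      P.α i * (P.α i * P.marginal x z 0 - deriv (P.c i) (x 0 i))
        - deriv (deriv (P.c i)) (x 0 i) * (-P.α i * x 0 i - z 0 i) := by
    rw [iteratedDerivWithin_succ, iteratedDerivWithin_one, derivWithin_congr e1 (e1 hmem)]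
    exact (hopt.hasDerivWithinAt_marginal_deriv hA1 hA3 i hmem).derivWithin (hU 0 hmem)
  -- Strong convexity makes the second-order relation solvable for `z 0 i`.
  have hpos : deriv (deriv (P.c i)) (x 0 i) ≠ 0 := by
    obtain ⟨μ, hμ, hc, -⟩ := hA1.costs
    exact (hμ.trans_le ((hc i).strong _)).ne'
  rw [e2, e1 hmem]
  constructor
  · simp [DemandDispatch.Model.marginal]
  · field_simp
    ring
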